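/- Lemma 2.2. Assume the Riemann hypothesis. Zeros of $\zeta$ are counted with multiplicity. For $\Re z>0$, $\Im z>0$ let $$F(z)=e^{-z/2}\sum_{\gamma>0}\frac{e^{\varrho z}}{\varrho},$$ the sum running over the nontrivial zeros $\varrho=\beta+i\gamma$ of $\zeta$ with $\gamma>0$. Let $\gamma_1\le\gamma_2\le\cdots$ be the positive imaginary parts of the nontrivial zeros of $\zeta$, put $a_n=1/(1/2+i\gamma_n)$, and for a non-negative integer $N$ let $F_N(z)=\sum_{n=1}^N a_n e^{i\gamma_n z}$. Let $$\varkappa=\lim_{Y\to0^+}\lim_{T\to\infty}\frac1T\,\#\{z=x+iy:\ F(z)=0,\ 0<x<T,\ y\ge Y\}\in[0,\infty],$$ where both limits are read as lower limits, so that $\varkappa$ is defined in any case and is the iterated limit whenever that exists; distinct zeros of $F$ are counted. Let $\xi$ be a zero of $F$ with $\Re \xi>0$ and $w:=\Im \xi>0$, and let $C$ be a Jordan curve in the upper half-plane $\Im z>0$ that encloses $\xi$. Put $$\alpha=\inf_{z\in C}|F_N(z)|,\quad y_0=\inf_{C}\Im z,\quad x_0=\inf_{C}\Re z,\quad x_1=\sup_{C}\Re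 z,$$ $$a=\sum_{n=1}^N|a_n|e^{-\gamma_n y_0},\quad b=\sum_{n=N+1}^\infty|a_n|e^{-\gamma_n y_0},\quad a_w=\sum_{n=1}^N|a_n|e^{-\gamma_n w},\quad b_w=\sum_{n=N+1}^\infty|a_n|e^{-\gamma_n w}.$$ If $\alpha>b+2b_w$ and $x_1-x_0<1$, then $\varkappa\ge q_0^{-N}$ for every positive integer $q_0$ such that $$2a_w\sin(\pi/q_0)+\frac{2\pi a}{q_0}\le\alpha-b-2b_w.$$ -/

import Mathlib

open Filter Topology

noncomputable section

namespace ZetaSum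

/-- The nontrivial zeros `ρ = β + iγ` of the Riemann zeta function with `γ > 0`. -/
def upperZeros : Set ℂ :=
  {ρ | riemannZeta ρ = 0 ∧ 0 < ρ.re ∧ ρ.re < 1 ∧ 0 < ρ.im}

/-- The multiplicity of `ρ` as a zero of the Riemann zeta function. -/
def mult (ρ : ℂ) : ℕ := analyticOrderNatAt riemannZeta ρ

/-- `F(z) = e^{-z/2} ∑_{γ > 0} e^{ρ z} / ρ`, the sum over the nontrivial zeros with `γ > 0`, each
repeated according to its multiplicity. The series converges absolutely for `Im z > 0`. -/
def F (z : ℂ) : ℂ :=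
  Complex.exp (-z / 2) * ∑' ρ : upperZeros, (mult ρ : ℂ) * (Complex.exp (ρ * z) / ρ)

/-- The number of nontrivial zeros, with multiplicity, with `0 < γ ≤ t`. -/
def zeroCount (t : ℝ) : ℕ := ∑ᶠ ρ ∈ {ρ ∈ upperZeros | ρ.im ≤ t}, mult ρ

/-- `γ_n` for `n ≥ 1`: the `n`-th positive imaginary part of a zero of zeta, in nondecreasing order
and with multiplicity, that is, the least height up to which there are at least `n` zeros. -/
def ordinate (n : ℕ) : ℝ := sInf {t : ℝ | 0 < t ∧ n ≤ zeroCount t}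

/-- `a_n = 1 / (1/2 + i γ_n)`. -/
def coeff (n : ℕ) : ℂ := 1 / (1 / 2 + Complex.I * (ordinate n : ℂ))

/-- `F_N(z) = ∑_{n = 1}^N a_n e^{i γ_n z}`. -/
def partialF (N : ℕ) (z : ℂ) : ℂ :=
  ∑ n ∈ Finset.Icc 1 N, coeff n * Complex.exp (Complex.I * (ordinate n : ℂ) * z)

/-- `∑_{n = 1}^N |a_n| e^{-γ_n y}`. -/
def headSum (N : ℕ) (y : ℝ) : ℝ :=
  ∑ n ∈ Finset.Icc 1 N, ‖coeff n‖ * Real.exp (-ordinate n * y)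

/-- `∑_{n = N+1}^∞ |a_n| e^{-γ_n y}`, a sum of nonnegative terms with value in `[0, ∞]`. -/
def tailSum (N : ℕ) (y : ℝ) : ENNReal :=
  ∑' k : ℕ, ENNReal.ofReal (‖coeff (N + 1 + k)‖ * Real.exp (-ordinate (N + 1 + k) * y))

/-- A Jordan curve in the plane: the image of a circle under a continuous injective map. -/
def IsJordanCurve (C : Set ℂ) : Prop :=
  ∃ f : Circle → ℂ, Continuous f ∧ Function.Injective f ∧ Set.range f = C

/-- The point `ξ` lies in a bounded component of the complement of `C`. -/
def Encloses (C : Set ℂ) (ξ : ℂ) : Prop :=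
  ξ ∉ C ∧ Bornology.IsBounded (connectedComponentIn Cᶜ ξ)

/-- `(1 / T) #{z = x + iy : F(z) = 0, 0 < x < T, y ≥ Y}`, counting distinct zeros. -/
def zeroFrequency (Y T : ℝ) : ENNReal :=
  (({z : ℂ | F z = 0 ∧ 0 < z.re ∧ z.re < T ∧ Y ≤ z.im}.encard : ℕ∞) : ENNReal) / ENNReal.ofReal T

/-- The density `ϰ = lim_{Y → 0+} lim_{T → ∞} (1/T) #{F(z) = 0, 0 < x < T, y ≥ Y}` in `[0, ∞]`, with
lower limits, so that it is defined whether or not the limits exist. -/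
def zeroDensity : ENNReal :=
  liminf (fun Y : ℝ => liminf (fun T : ℝ => zeroFrequency Y T) atTop) (𝓝[>] 0)

/-- Where the iterated limit exists, `zeroDensity` is that limit. -/
theorem zeroDensity_eq_of_tendsto (d : ℝ → ENNReal) (κ : ENNReal)
    (hd : ∀ᶠ Y in 𝓝[>] (0 : ℝ), Tendsto (fun T : ℝ => zeroFrequency Y T) atTop (𝓝 (d Y)))
    (hκ : Tendsto d (𝓝[>] 0) (𝓝 κ)) : zeroDensity = κ := by
  rw [← hκ.liminf_eq]
  exact liminf_congr (hd.mono fun Y hY => hY.liminf_eq)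

end ZetaSum

end

/-!
The zeros of `F` recur because `F_N` is almost periodic. By the pigeonhole principle on the
`N`-dimensional torus, a proportion at least `q₀ ^ (-N)` of the integers `m` bring every
`m γ_n / 2π`, `n ≤ N`, closer than `1 / q₀` to an integer (`exists_simultaneous_approx`). For such
an `m` the functions `F_N(z + m)` and `F_N(z)` differ by at most `2 sin(π / q₀) ∑ |a_n| e^{-γ_n y}`.
As `F ξ = 0`, this makes `|F(ξ + m)|` at most `2 a_w sin(π / q₀) + 2 b_w`, while on `C` one has
`|F(z + m)| ≥ α - 2 a sin(π / q₀) - b`, which is larger because `sin(π / q₀) < π / q₀`. The minimum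
modulus principle, applied to `z ↦ F(z + m)` on the component `U` of the complement of `C` that
contains `ξ`, yields a zero of `F` in `U + m` (`exists_zero_in_translate`). No form of the Jordan
curve theorem is needed: it suffices that `U` is open and bounded with frontier contained in `C`.
Since `U` has width less than `1`, zeros from distinct `m` are distinct, and counting them bounds the
density (`le_zeroDensity`).

The sum over zeros that defines `F` has to be rewritten as a sum over the ordinates `γ_n`
(`F_eq_tsum_term`). The fibre of `n ↦ γ_n` over a zero `ρ` has `mult ρ` elements, since
`γ_n ≤ t` if and only if `n ≤ zeroCount t`. That there are infinitely many zeros, and that the series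
converges absolutely for `Im z ≥ y₀`, are both contained in the finiteness of the tail `b`.
-/

open Filter Topology

namespace ZetaSum

/-! ### Enumeration of the zeros by their ordinates -/

theorem re_eq_half_of_mem_upperZeros (hRH : RiemannHypothesis) {ρ : ℂ} (hρ : ρ ∈ upperZeros) :
    ρ.re = 1 / 2 := by
  obtain ⟨h0, hre, hre1, him⟩ := hρ
  refine hRH ρ h0 ?_ ?_
  · rintro ⟨n, rfl⟩
    simp at him
  · rintro rfl
    simp at him

theorem eq_half_add_of_mem_upperZeros (hRH : RiemannHypothesis) {ρ : ℂ} (hρ : ρ ∈ upperZeros) :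
    ρ = 1 / 2 + Complex.I * (ρ.im : ℂ) := by
  apply Complex.ext
  · simp [re_eq_half_of_mem_upperZeros hRH hρ]
  · simp

theorem analyticOnNhd_riemannZeta : AnalyticOnNhd ℂ riemannZeta {1}ᶜ :=
  DifferentiableOn.analyticOnNhd
    (fun _ hs => (differentiableAt_riemannZeta hs).differentiableWithinAt) isOpen_compl_singleton

theorem finite_upperZeros_le (hRH : RiemannHypothesis) (t : ℝ) :
    {ρ ∈ upperZeros | ρ.im ≤ t}.Finite := by
  by_contra hinf
  -- Under the Riemann hypothesis the zeros lie on a segment of the critical line, which is compact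
  -- and avoids the pole at `1`.
  let K : Set ℂ := (fun s : ℝ => (1 / 2 + Complex.I * (s : ℂ) : ℂ)) '' Set.Icc 0 t
  have hK : IsCompact K := isCompact_Icc.image (by fun_prop)
  have hsub : {ρ ∈ upperZeros | ρ.im ≤ t} ⊆ K := fun ρ hρ =>
    ⟨ρ.im, ⟨hρ.1.2.2.2.le, hρ.2⟩, (eq_half_add_of_mem_upperZeros hRH hρ.1).symm⟩
  obtain ⟨x, ⟨s, -, rfl⟩, hx⟩ :=
    Set.Infinite.exists_accPt_of_subset_isCompact hinf hK hsub
  rw [accPt_iff_frequently_nhdsNE] at hx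
  have hpre : IsPreconnected ({1}ᶜ : Set ℂ) :=
    (isConnected_compl_singleton_of_one_lt_rank (by simp) 1).isPreconnected
  have hne : (1 / 2 + Complex.I * (s : ℂ) : ℂ) ∈ ({1}ᶜ : Set ℂ) := by
    intro h
    have := congrArg Complex.re h
    norm_num at this
  have h2 := analyticOnNhd_riemannZeta.eqOn_zero_of_preconnected_of_frequently_eq_zero hpre hne
    (hx.mono fun y hy => hy.1.1) (show (2 : ℂ) ∈ ({1}ᶜ : Set ℂ) by simp)
  exact riemannZeta_ne_zero_of_one_le_re (s := 2) (by simp) h2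

theorem ordinate_nonneg (n : ℕ) : 0 ≤ ordinate n :=
  Real.sInf_nonneg fun _ ht => ht.1.le

theorem zeroCount_eventually_right (hRH : RiemannHypothesis) (t : ℝ) :
    ∀ᶠ s in 𝓝[>] t, zeroCount s = zeroCount t := by
  have hfin := finite_upperZeros_le hRH (t + 1)
  have h : ∀ᶠ s in 𝓝[>] t, ∀ ρ ∈ {ρ ∈ upperZeros | ρ.im ≤ t + 1}, ρ.im ≤ s → ρ.im ≤ t := by
    rw [hfin.eventually_all]
    intro ρ _
    by_cases hρ : ρ.im ≤ t
    · exact Eventually.of_forall fun _ _ => hρ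
    · have : ∀ᶠ s in 𝓝[>] t, s < ρ.im :=
        mem_nhdsWithin_of_mem_nhds (Iio_mem_nhds (not_le.mp hρ))
      exact this.mono fun s hs h => absurd h (not_le.mpr hs)
  have h1 : ∀ᶠ s in 𝓝[>] t, s < t + 1 :=
    mem_nhdsWithin_of_mem_nhds (Iio_mem_nhds (lt_add_one t))
  filter_upwards [h, h1, self_mem_nhdsWithin] with s hs hs1 hts
  have : {ρ ∈ upperZeros | ρ.im ≤ s} = {ρ ∈ upperZeros | ρ.im ≤ t} := by
    ext ρ
    exact ⟨fun hρ => ⟨hρ.1, hs ρ ⟨hρ.1, hρ.2.trans hs1.le⟩ hρ.2⟩,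
      fun hρ => ⟨hρ.1, hρ.2.trans (le_of_lt hts)⟩⟩
  rw [zeroCount, zeroCount, this]

theorem eventually_left_zeros_le_eq (hRH : RiemannHypothesis) (t : ℝ) :
    ∀ᶠ s in 𝓝[<] t, {ρ ∈ upperZeros | ρ.im ≤ s} = {ρ ∈ upperZeros | ρ.im < t} := by
  have hfin := finite_upperZeros_le hRH t
  have h : ∀ᶠ s in 𝓝[<] t, ∀ ρ ∈ {ρ ∈ upperZeros | ρ.im ≤ t}, ρ.im < t → ρ.im ≤ s := by
    rw [hfin.eventually_all]
    intro ρ _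
    by_cases hρ : ρ.im < t
    · have : ∀ᶠ s in 𝓝[<] t, ρ.im < s := mem_nhdsWithin_of_mem_nhds (Ioi_mem_nhds hρ)
      exact this.mono fun s hs _ => hs.le
    · exact Eventually.of_forall fun _ h => absurd h hρ
  filter_upwards [h, self_mem_nhdsWithin] with s hs hst
  ext ρ
  exact ⟨fun hρ => ⟨hρ.1, hρ.2.trans_lt hst⟩, fun hρ => ⟨hρ.1, hs ρ ⟨hρ.1, hρ.2.le⟩ hρ.2⟩⟩

theorem zeroCount_mono (hRH : RiemannHypothesis) : Monotone zeroCount := by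
  intro s t hst
  rw [zeroCount, zeroCount, finsum_mem_eq_finite_toFinset_sum _ (finite_upperZeros_le hRH s),
    finsum_mem_eq_finite_toFinset_sum _ (finite_upperZeros_le hRH t)]
  refine Finset.sum_le_sum_of_subset fun ρ hρ => ?_
  simp only [Set.Finite.mem_toFinset, Set.mem_ofPred_eq] at hρ ⊢
  exact ⟨hρ.1, hρ.2.trans hst⟩

theorem zeroCount_of_nonpos {t : ℝ} (ht : t ≤ 0) : zeroCount t = 0 := by
  have : {ρ ∈ upperZeros | ρ.im ≤ t} = ∅ := by
    ext ρ
    simp only [Set.mem_ofPred_eq, Set.mem_empty_iff_false, iff_false, not_and, not_le]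
    exact fun h => ht.trans_lt h.2.2.2
  rw [zeroCount, this, finsum_mem_empty]

/-- The jump of the counting function at the height of a zero is the multiplicity of that zero. -/
theorem exists_zeroCount_eq_add_mult (hRH : RiemannHypothesis) {ρ : ℂ} (hρ : ρ ∈ upperZeros) :
    ∃ L, zeroCount ρ.im = L + mult ρ ∧ ∀ᶠ s in 𝓝[<] ρ.im, zeroCount s = L := by
  refine ⟨∑ᶠ ρ' ∈ {ρ' ∈ upperZeros | ρ'.im < ρ.im}, mult ρ', ?_,
    (eventually_left_zeros_le_eq hRH ρ.im).mono fun s hs => by rw [zeroCount, hs]⟩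
  have : {ρ' ∈ upperZeros | ρ'.im ≤ ρ.im} = insert ρ {ρ' ∈ upperZeros | ρ'.im < ρ.im} := by
    ext ρ'
    simp only [Set.mem_ofPred_eq, Set.mem_insert_iff]
    constructor
    · rintro ⟨h, hle⟩
      rcases hle.lt_or_eq with hlt | heq
      · exact Or.inr ⟨h, hlt⟩
      · left
        rw [eq_half_add_of_mem_upperZeros hRH h, eq_half_add_of_mem_upperZeros hRH hρ, heq]
    · rintro (rfl | ⟨h, hlt⟩)
      · exact ⟨hρ, le_rfl⟩
      · exact ⟨h, hlt.le⟩
  rw [zeroCount, this, finsum_mem_insert _ (by simp), add_comm]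
  exact (finite_upperZeros_le hRH ρ.im).subset fun ρ' h => ⟨h.1, le_of_lt h.2⟩

/-- The ordinates and the counting function form a Galois connection, as soon as there are
infinitely many zeros; otherwise `ordinate n` is the junk value `0` for large `n`. -/
theorem ordinate_le_iff (hRH : RiemannHypothesis) (hinf : ∀ n, ∃ t, n ≤ zeroCount t)
    {n : ℕ} (hn : 0 < n) (t : ℝ) : ordinate n ≤ t ↔ n ≤ zeroCount t := by
  have hpos : ∀ {s}, n ≤ zeroCount s → 0 < s := fun {s} hs => by
    by_contra h
    rw [zeroCount_of_nonpos (not_lt.mp h)] at hs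
    omega
  have hbdd : BddBelow {t : ℝ | 0 < t ∧ n ≤ zeroCount t} := ⟨0, fun _ ht => ht.1.le⟩
  constructor
  · intro h
    obtain ⟨s, hs, hts⟩ :=
      ((zeroCount_eventually_right hRH t).and self_mem_nhdsWithin).exists
    obtain ⟨s₀, hs₀⟩ := hinf n
    obtain ⟨r, hr, hrs⟩ := exists_lt_of_csInf_lt
      (s := {t : ℝ | 0 < t ∧ n ≤ zeroCount t}) ⟨s₀, hpos hs₀, hs₀⟩ (h.trans_lt hts)
    exact hs ▸ hr.2.trans (zeroCount_mono hRH hrs.le)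
  · intro h
    exact csInf_le hbdd ⟨hpos h, h⟩

theorem half_add_ordinate_mem_upperZeros (hRH : RiemannHypothesis)
    (hinf : ∀ n, ∃ t, n ≤ zeroCount t) {n : ℕ} (hn : 0 < n) :
    (1 / 2 + Complex.I * (ordinate n : ℂ)) ∈ upperZeros := by
  obtain ⟨s, hs, hst⟩ :=
    ((eventually_left_zeros_le_eq hRH (ordinate n)).and self_mem_nhdsWithin).exists
  have h1 : n ≤ zeroCount (ordinate n) := (ordinate_le_iff hRH hinf hn _).mp le_rfl
  have h2 : ¬ n ≤ zeroCount s := fun h => not_le.mpr hst ((ordinate_le_iff hRH hinf hn s).mpr h)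
  by_contra hmem
  have : {ρ ∈ upperZeros | ρ.im ≤ ordinate n} = {ρ ∈ upperZeros | ρ.im < ordinate n} := by
    ext ρ
    refine ⟨fun h => ⟨h.1, h.2.lt_of_ne fun heq => hmem ?_⟩, fun h => ⟨h.1, le_of_lt h.2⟩⟩
    rw [← heq, ← eq_half_add_of_mem_upperZeros hRH h.1]
    exact h.1
  rw [zeroCount, hs, ← this] at h2
  exact h2 h1

theorem card_ordinate_fiber (hRH : RiemannHypothesis) (hinf : ∀ n, ∃ t, n ≤ zeroCount t)
    {ρ : ℂ} (hρ : ρ ∈ upperZeros) : Nat.card {k : ℕ | ordinate (k + 1) = ρ.im} = mult ρ := by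
  obtain ⟨L, hL, hev⟩ := exists_zeroCount_eq_add_mult hRH hρ
  have : {k : ℕ | ordinate (k + 1) = ρ.im} = Finset.Ico L (L + mult ρ) := by
    ext k
    have hlt : ordinate (k + 1) < ρ.im ↔ k + 1 ≤ L := by
      constructor
      · intro h
        have h' : ∀ᶠ s in 𝓝[<] ρ.im, ordinate (k + 1) < s :=
          mem_nhdsWithin_of_mem_nhds (Ioi_mem_nhds h)
        obtain ⟨s, hs, hs'⟩ := (hev.and h').exists
        rw [← hs]
        exact (ordinate_le_iff hRH hinf k.succ_pos s).mp hs'.le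
      · intro h
        obtain ⟨s, hs, hs'⟩ := (hev.and self_mem_nhdsWithin).exists
        exact ((ordinate_le_iff hRH hinf k.succ_pos s).mpr (hs ▸ h)).trans_lt hs'
    have hle := ordinate_le_iff hRH hinf k.succ_pos ρ.im
    rw [hL] at hle
    simp only [Set.mem_ofPred_eq, Finset.coe_Ico, Set.mem_Ico]
    rw [eq_iff_le_not_lt, hlt]
    simp only [Nat.succ_eq_add_one] at hle
    rw [hle]
    omega
  rw [this, Nat.card_eq_fintype_card]
  simp

/-! ### The series over the ordinates -/

/-- The `k`-th term of `F(z) = ∑_{n ≥ 1} a_n e^{i γ_n z}`, with `n = k + 1`. -/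
noncomputable def term (k : ℕ) (z : ℂ) : ℂ :=
  coeff (k + 1) * Complex.exp (Complex.I * (ordinate (k + 1) : ℂ) * z)

theorem norm_term (k : ℕ) (z : ℂ) :
    ‖term k z‖ = ‖coeff (k + 1)‖ * Real.exp (-ordinate (k + 1) * z.im) := by
  rw [term, norm_mul, Complex.norm_exp]
  simp

theorem norm_term_le (k : ℕ) {z : ℂ} {y : ℝ} (hz : y ≤ z.im) :
    ‖term k z‖ ≤ ‖coeff (k + 1)‖ * Real.exp (-ordinate (k + 1) * y) := by
  rw [norm_term]
  gcongr ?_ * Real.exp ?_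
  nlinarith [ordinate_nonneg (k + 1)]

theorem sum_Icc_one_eq_sum_range {M : Type*} [AddCommMonoid M] (f : ℕ → M) (N : ℕ) :
    ∑ n ∈ Finset.Icc 1 N, f n = ∑ k ∈ Finset.range N, f (k + 1) := by
  induction N with
  | zero => simp
  | succ N ih => rw [Finset.sum_Icc_succ_top (by omega), Finset.sum_range_succ, ih]

theorem partialF_eq_sum_term (N : ℕ) (z : ℂ) : partialF N z = ∑ k ∈ Finset.range N, term k z :=
  sum_Icc_one_eq_sum_range _ N

theorem headSum_eq_sum_range (N : ℕ) (y : ℝ) :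
    headSum N y = ∑ k ∈ Finset.range N, ‖coeff (k + 1)‖ * Real.exp (-ordinate (k + 1) * y) :=
  sum_Icc_one_eq_sum_range _ N

theorem norm_partialF_le_headSum (N : ℕ) {z : ℂ} {y : ℝ} (hz : y ≤ z.im) :
    ‖partialF N z‖ ≤ headSum N y := by
  rw [partialF_eq_sum_term, headSum_eq_sum_range]
  exact norm_sum_le_of_le _ fun k _ => norm_term_le k hz

theorem summable_of_tailSum_ne_top {N : ℕ} {y : ℝ} (h : tailSum N y ≠ ⊤) :
    Summable fun k => ‖coeff (k + 1)‖ * Real.exp (-ordinate (k + 1) * y) := by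
  rw [← summable_nat_add_iff N]
  have := ENNReal.summable_toReal h
  refine this.congr fun k => ?_
  rw [ENNReal.toReal_ofReal (by positivity), show N + 1 + k = k + N + 1 by ring]

/-- A finite tail forces infinitely many zeros: missing ordinates take the junk value `0`, and each
of them would contribute `‖1 / (1 / 2)‖ = 2` to the tail. -/
theorem exists_le_zeroCount {N : ℕ} {y : ℝ} (h : tailSum N y ≠ ⊤) (n : ℕ) :
    ∃ t, n ≤ zeroCount t := by
  by_contra! hn
  have hs := (summable_of_tailSum_ne_top h).tendsto_atTop_zero
  have h2 : ∀ᶠ k : ℕ in atTop,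
      ‖coeff (k + 1)‖ * Real.exp (-ordinate (k + 1) * y) = 2 := by
    filter_upwards [eventually_ge_atTop n] with k hk
    have h0 : ordinate (k + 1) = 0 := by
      have : {t : ℝ | 0 < t ∧ k + 1 ≤ zeroCount t} = ∅ := by
        ext t
        have := hn t
        simp only [Set.mem_ofPred_eq, Set.mem_empty_iff_false, iff_false, not_and]
        omega
      rw [ordinate, this, Real.sInf_empty]
    simp [coeff, h0]
  have := tendsto_nhds_unique (hs.congr' h2) tendsto_const_nhds
  norm_num at this

theorem summable_term {N : ℕ} {y : ℝ} (h : tailSum N y ≠ ⊤) {z : ℂ} (hz : y ≤ z.im) :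
    Summable fun k => term k z :=
  Summable.of_norm_bounded (summable_of_tailSum_ne_top h) fun k => norm_term_le k hz

theorem F_eq_tsum_term (hRH : RiemannHypothesis) {N : ℕ} {y : ℝ} (h : tailSum N y ≠ ⊤)
    {z : ℂ} (hz : y ≤ z.im) : F z = ∑' k, term k z := by
  have hinf := exists_le_zeroCount h
  let g : ℕ → upperZeros := fun k => ⟨_, half_add_ordinate_mem_upperZeros hRH hinf k.succ_pos⟩
  rw [← ((summable_term h hz).hasSum.tsum_fiberwise g).tsum_eq, F, ← tsum_mul_left]
  refine tsum_congr fun ρ => ?_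
  have hfib : g ⁻¹' {ρ} = {k : ℕ | ordinate (k + 1) = (ρ : ℂ).im} := by
    ext k
    simp only [Set.mem_preimage, Set.mem_singleton_iff, Set.mem_ofPred_eq]
    constructor
    · intro hk
      rw [← hk]
      simp [g]
    · intro hk
      apply Subtype.ext
      rw [eq_half_add_of_mem_upperZeros hRH ρ.2, ← hk]
  have hterm : ∀ k : g ⁻¹' {ρ}, term k z = Complex.exp (-z / 2) * (Complex.exp (ρ * z) / ρ) := by
    rintro ⟨k, hk⟩
    rw [hfib] at hk
    have hρ := eq_half_add_of_mem_upperZeros hRH ρ.2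
    rw [← (show ordinate (k + 1) = (ρ : ℂ).im from hk)] at hρ
    rw [term, coeff, ← hρ, ← mul_div_assoc, ← Complex.exp_add, one_div_mul_eq_div]
    congr 2
    rw [hρ]
    ring
  rw [tsum_congr hterm, tsum_const, hfib, card_ordinate_fiber hRH hinf ρ.2, nsmul_eq_mul]
  ring

theorem norm_F_sub_partialF_le (hRH : RiemannHypothesis) {N : ℕ} {y : ℝ} (h : tailSum N y ≠ ⊤)
    {z : ℂ} (hz : y ≤ z.im) : ‖F z - partialF N z‖ ≤ (tailSum N y).toReal := by
  have hs := summable_term h hz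
  rw [F_eq_tsum_term hRH h hz, partialF_eq_sum_term, ← hs.sum_add_tsum_nat_add N,
    add_sub_cancel_left, tailSum, ENNReal.tsum_toReal_eq (fun _ => ENNReal.ofReal_ne_top)]
  have hb := (summable_nat_add_iff N).mpr (summable_of_tailSum_ne_top h)
  refine (tsum_of_norm_bounded hb.hasSum fun k => norm_term_le (k + N) hz).trans_eq ?_
  refine tsum_congr fun k => ?_
  rw [ENNReal.toReal_ofReal (by positivity), show N + 1 + k = k + N + 1 by ring]

theorem continuousOn_F (hRH : RiemannHypothesis) {N : ℕ} {y : ℝ} (h : tailSum N y ≠ ⊤) :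
    ContinuousOn F {z | y ≤ z.im} := by
  refine ContinuousOn.congr ?_ fun z hz => F_eq_tsum_term hRH h hz
  exact continuousOn_tsum (fun k => by unfold term; fun_prop) (summable_of_tailSum_ne_top h)
    fun k z hz => norm_term_le k hz

theorem differentiableOn_F (hRH : RiemannHypothesis) {N : ℕ} {y : ℝ} (h : tailSum N y ≠ ⊤) :
    DifferentiableOn ℂ F {z | y < z.im} := by
  refine DifferentiableOn.congr ?_ fun z hz => F_eq_tsum_term hRH h (le_of_lt hz)
  exact Complex.differentiableOn_tsum_of_summable_norm (summable_of_tailSum_ne_top h)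
    (fun k => by unfold term; fun_prop) (isOpen_lt continuous_const Complex.continuous_im)
    fun k z hz => norm_term_le k (le_of_lt hz)

/-! ### Simultaneous approximation by the pigeonhole principle -/

/-- Among the integers `0 ≤ m ≤ M`, a proportion at least `q ^ (-N)` brings all of the multiples
`m θ_n` closer than `1 / q` to an integer: sort the `m` by the cube of side `1 / q` of the torus
that contains `(m θ_n)_n`, and subtract the least element of the largest class. -/
theorem exists_simultaneous_approx {N q : ℕ} (hq : 0 < q) (θ : Fin N → ℝ) (M : ℕ) :
    ∃ A : Finset ℕ, (∀ m ∈ A, m ≤ M) ∧ ((M : ℝ) + 1) / (q : ℝ) ^ N ≤ A.card ∧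
      ∀ m ∈ A, ∀ n, ∃ k : ℤ, |m * θ n - k| < 1 / q := by
  have hq' : (0 : ℝ) < q := by exact_mod_cast hq
  have hlt : ∀ x : ℝ, ⌊q * Int.fract x⌋₊ < q := fun x => by
    rw [Nat.floor_lt (by have := Int.fract_nonneg x; positivity)]
    nlinarith [Int.fract_lt_one x]
  let c : ℕ → Fin N → Fin q := fun m n => ⟨⌊q * Int.fract (m * θ n)⌋₊, hlt _⟩
  obtain ⟨v, -, hv⟩ := Finset.exists_le_card_fiber_of_nsmul_le_card_of_maps_to
    (s := Finset.range (M + 1)) (t := Finset.univ) (f := c) (b := ((M : ℝ) + 1) / (q : ℝ) ^ N)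
    (fun _ _ => Finset.mem_univ _) ⟨fun _ => ⟨0, hq⟩, Finset.mem_univ _⟩ (by
      simp only [Finset.card_univ, Fintype.card_pi, Fintype.card_fin, Finset.prod_const,
        Finset.card_range, nsmul_eq_mul]
      push_cast
      field_simp
      exact le_rfl)
  set B := (Finset.range (M + 1)).filter fun m => c m = v with hB
  have hBne : B.Nonempty := by
    rw [← Finset.card_pos]
    have : (0 : ℝ) < ((M : ℝ) + 1) / (q : ℝ) ^ N := by positivity
    exact_mod_cast this.trans_le hv
  set m₀ := B.min' hBne
  have hm₀ : ∀ m ∈ B, m₀ ≤ m := fun m hm => B.min'_le m hm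
  refine ⟨B.image (· - m₀), ?_, ?_, ?_⟩
  · intro m hm
    obtain ⟨m', hm', rfl⟩ := Finset.mem_image.mp hm
    have := (Finset.mem_filter.mp hm').1
    rw [Finset.mem_range] at this
    omega
  · rw [Finset.card_image_of_injOn]
    · exact hv
    · intro a ha b hb hab
      have := hm₀ a ha
      have := hm₀ b hb
      simp only at hab
      omega
  · intro m hm n
    obtain ⟨m', hm', rfl⟩ := Finset.mem_image.mp hm
    have h1 : c m' = c m₀ := by
      rw [(Finset.mem_filter.mp hm').2, (Finset.mem_filter.mp (B.min'_mem hBne)).2]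
    have h2 : ⌊q * Int.fract (m' * θ n)⌋₊ = ⌊q * Int.fract (m₀ * θ n)⌋₊ :=
      congrArg Fin.val (congrFun h1 n)
    refine ⟨⌊m' * θ n⌋ - ⌊m₀ * θ n⌋, ?_⟩
    have e : (((m' - m₀ : ℕ) : ℝ) * θ n - ((⌊m' * θ n⌋ - ⌊m₀ * θ n⌋ : ℤ) : ℝ))
        = Int.fract (m' * θ n) - Int.fract (m₀ * θ n) := by
      rw [Nat.cast_sub (hm₀ m' hm'), Int.fract, Int.fract]
      push_cast
      ring
    rw [e, lt_div_iff₀ hq']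
    have f1 := Int.fract_nonneg (m' * θ n)
    have f2 := Int.fract_nonneg (m₀ * θ n)
    have a1 := Nat.floor_le (show 0 ≤ q * Int.fract (m' * θ n) by positivity)
    have a2 := Nat.lt_floor_add_one (q * Int.fract (m' * θ n))
    have b1 := Nat.floor_le (show 0 ≤ q * Int.fract (m₀ * θ n) by positivity)
    have b2 := Nat.lt_floor_add_one (q * Int.fract (m₀ * θ n))
    rw [h2] at a1 a2
    rw [← abs_of_pos hq', ← abs_mul, abs_lt]
    constructor <;> nlinarith

/-! ### The region inside a curve -/

theorem frontier_connectedComponentIn_compl_subset {C : Set ℂ} (hC : IsClosed C) (ξ : ℂ) :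
    frontier (connectedComponentIn Cᶜ ξ) ⊆ C := by
  intro z hz
  by_contra hzC
  have hopen := hC.isOpen_compl.connectedComponentIn (x := ξ)
  have hV := hC.isOpen_compl.connectedComponentIn (x := z)
  obtain ⟨u, hu, hu'⟩ := mem_closure_iff.mp (frontier_subset_closure hz) _ hV
    (mem_connectedComponentIn hzC)
  have hzU : z ∈ connectedComponentIn Cᶜ ξ := by
    rw [connectedComponentIn_eq hu', ← connectedComponentIn_eq hu]
    exact mem_connectedComponentIn hzC
  rw [hopen.frontier_eq] at hz
  exact hz.2 hzU

theorem exists_mem_frontier_lt {U : Set ℂ} (hU : IsOpen U) (hb : Bornology.IsBounded U)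
    {f : ℂ → ℝ} (hf : Continuous f) (hf' : IsOpenMap f) {z : ℂ} (hz : z ∈ U) :
    ∃ c ∈ frontier U, f c < f z := by
  have hsmaller : ∀ u ∈ U, ∃ v ∈ U, f v < f u := fun u hu => by
    have h1 : ∀ᶠ x in 𝓝[<] f u, x ∈ f '' U :=
      mem_nhdsWithin_of_mem_nhds ((hf' U hU).mem_nhds ⟨u, hu, rfl⟩)
    obtain ⟨_, ⟨v, hv, rfl⟩, hlt⟩ := (h1.and self_mem_nhdsWithin).exists
    exact ⟨v, hv, hlt⟩
  obtain ⟨p, hp, hmin⟩ :=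
    hb.isCompact_closure.exists_isMinOn ⟨z, subset_closure hz⟩ hf.continuousOn
  obtain ⟨v, hv, hvz⟩ := hsmaller z hz
  refine ⟨p, ?_, lt_of_le_of_lt (hmin (subset_closure hv)) hvz⟩
  rw [hU.frontier_eq]
  refine ⟨hp, fun hpU => ?_⟩
  obtain ⟨u, hu, hup⟩ := hsmaller p hpU
  exact not_le.mpr hup (hmin (subset_closure hu))

theorem exists_mem_frontier_gt {U : Set ℂ} (hU : IsOpen U) (hb : Bornology.IsBounded U)
    {f : ℂ → ℝ} (hf : Continuous f) (hf' : IsOpenMap f) {z : ℂ} (hz : z ∈ U) :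
    ∃ c ∈ frontier U, f z < f c := by
  obtain ⟨c, hc, h⟩ := exists_mem_frontier_lt hU hb hf.neg
    ((Homeomorph.neg ℝ).isOpenMap.comp hf') hz
  exact ⟨c, hc, neg_lt_neg_iff.mp h⟩

/-- A minimum modulus principle: otherwise `1 / f` would violate the maximum principle. -/
theorem exists_zero_of_norm_lt_frontier {U : Set ℂ} (hU : IsOpen U) (hb : Bornology.IsBounded U)
    {f : ℂ → ℂ} (hf : DiffContOnCl ℂ f U) {ξ : ℂ} (hξ : ξ ∈ U) {r : ℝ}
    (hr : ∀ z ∈ frontier U, r ≤ ‖f z‖) (hlt : ‖f ξ‖ < r) : ∃ z ∈ U, f z = 0 := by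
  by_contra! hne
  have hr0 : 0 < r := (norm_nonneg _).trans_lt hlt
  have hcl : ∀ z ∈ closure U, f z ≠ 0 := by
    intro z hz
    by_cases hzU : z ∈ U
    · exact hne z hzU
    · have := hr z (by rw [hU.frontier_eq]; exact ⟨hz, hzU⟩)
      exact norm_pos_iff.mp (hr0.trans_le this)
  have hle := Complex.norm_le_of_forall_mem_frontier_norm_le hb (hf.inv hcl) (C := r⁻¹)
    (fun z hz => by
      rw [Pi.inv_apply, norm_inv]
      exact inv_anti₀ hr0 (hr z hz)) (subset_closure hξ)
  rw [Pi.inv_apply, norm_inv, inv_le_inv₀ (norm_pos_iff.mpr (hne ξ hξ)) hr0] at hle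
  exact not_le.mpr hlt hle

/-! ### Zeros in translates of the region -/

theorem norm_exp_sub_one_le_of_abs_sub_int_lt {q : ℕ} (hq : 2 ≤ q) {x : ℝ} {k : ℤ}
    (h : |x - k| < 1 / q) :
    ‖Complex.exp (Complex.I * (2 * Real.pi * x : ℝ)) - 1‖ ≤ 2 * Real.sin (Real.pi / q) := by
  have hq' : (2 : ℝ) ≤ q := by exact_mod_cast hq
  have e : Complex.exp (Complex.I * (2 * Real.pi * x : ℝ))
      = Complex.exp (Complex.I * (2 * Real.pi * (x - k) : ℝ)) := by
    rw [Complex.exp_eq_exp_iff_exists_int]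
    refine ⟨k, ?_⟩
    push_cast
    ring
  have hle : |Real.pi * (x - k)| ≤ Real.pi / q := by
    rw [abs_mul, abs_of_pos Real.pi_pos, div_eq_mul_one_div]
    exact mul_le_mul_of_nonneg_left h.le Real.pi_pos.le
  have hhalf : Real.pi / q ≤ Real.pi / 2 := by gcongr
  rw [e, Complex.norm_exp_I_mul_ofReal_sub_one, norm_mul, Real.norm_ofNat, Real.norm_eq_abs,
    show 2 * Real.pi * (x - k) / 2 = Real.pi * (x - k) by ring,
    Real.abs_sin_eq_sin_abs_of_abs_le_pi (by linarith [Real.pi_pos])]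
  gcongr
  exact Real.sin_le_sin_of_le_of_le_pi_div_two (by linarith [abs_nonneg (Real.pi * (x - k)),
    Real.pi_pos]) hhalf hle

theorem norm_partialF_add_sub_le {N m : ℕ} {δ y : ℝ}
    (hm : ∀ k < N, ‖Complex.exp (Complex.I * (m * ordinate (k + 1) : ℝ)) - 1‖ ≤ δ)
    {z : ℂ} (hz : y ≤ z.im) : ‖partialF N (z + m) - partialF N z‖ ≤ δ * headSum N y := by
  rw [partialF_eq_sum_term, partialF_eq_sum_term, ← Finset.sum_sub_distrib, headSum_eq_sum_range,
    Finset.mul_sum]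
  refine norm_sum_le_of_le _ fun k hk => ?_
  have e : term k (z + m) - term k z
      = (Complex.exp (Complex.I * (m * ordinate (k + 1) : ℝ)) - 1) * term k z := by
    rw [term, term, mul_add, Complex.exp_add]
    push_cast
    rw [show Complex.I * (ordinate (k + 1) : ℂ) * (m : ℂ)
      = Complex.I * (m * (ordinate (k + 1) : ℂ)) by ring]
    ring
  rw [e, norm_mul]
  exact mul_le_mul (hm k (Finset.mem_range.mp hk)) (norm_term_le k hz) (norm_nonneg _)
    ((norm_nonneg _).trans (hm k (Finset.mem_range.mp hk)))

/-- If `m` is an almost period of the head `F_N`, then `F (z + m)` is small at the zero `ξ` of `F`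
and large on the boundary, so that the minimum modulus principle gives a zero in `U + m`. -/
theorem exists_zero_in_translate (hRH : RiemannHypothesis) {N : ℕ} {U : Set ℂ} (hU : IsOpen U)
    (hb : Bornology.IsBounded U) {y α δ : ℝ} (hyU : ∀ z ∈ U, y < z.im)
    (hyC : ∀ z ∈ frontier U, y ≤ z.im) (hαC : ∀ z ∈ frontier U, α ≤ ‖partialF N z‖)
    {ξ : ℂ} (hξU : ξ ∈ U) (hξ : F ξ = 0)
    (htail : tailSum N y ≠ ⊤) (htail' : tailSum N ξ.im ≠ ⊤) {m : ℕ}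
    (hm : ∀ k < N, ‖Complex.exp (Complex.I * (m * ordinate (k + 1) : ℝ)) - 1‖ ≤ δ)
    (hlt : δ * headSum N ξ.im + 2 * (tailSum N ξ.im).toReal
      < α - δ * headSum N y - (tailSum N y).toReal) :
    ∃ z ∈ U, F (z + m) = 0 := by
  have him : ∀ z : ℂ, (z + m).im = z.im := fun z => by simp
  have hcl : ∀ z ∈ closure U, y ≤ z.im := fun z hz => by
    by_cases hzU : z ∈ U
    · exact (hyU z hzU).le
    · exact hyC z (by rw [hU.frontier_eq]; exact ⟨hz, hzU⟩)
  have hdiff : DiffContOnCl ℂ (fun z => F (z + m)) U :=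
    ⟨(differentiableOn_F hRH htail).comp (by fun_prop) fun z hz => by
        simpa [him] using hyU z hz,
      (continuousOn_F hRH htail).comp (by fun_prop) fun z hz => by
        simpa [him] using hcl z hz⟩
  refine exists_zero_of_norm_lt_frontier hU hb hdiff hξU
    (r := α - δ * headSum N y - (tailSum N y).toReal) (fun z hz => ?_) (lt_of_le_of_lt ?_ hlt)
  · have h1 := norm_partialF_add_sub_le hm (hyC z hz)
    have h2 := norm_F_sub_partialF_le hRH htail (z := z + m) (by rw [him]; exact hyC z hz)
    have h3 := hαC z hz
    have h4 := norm_sub_norm_le (partialF N z) (F (z + m))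
    have h5 := norm_sub_le_norm_sub_add_norm_sub (partialF N z) (partialF N (z + m)) (F (z + m))
    rw [norm_sub_rev] at h1 h2
    linarith
  · have h1 := norm_partialF_add_sub_le hm (le_refl ξ.im)
    have h2 := norm_F_sub_partialF_le hRH htail' (z := ξ + m) (him ξ).ge
    have h3 := norm_F_sub_partialF_le hRH htail' (le_refl ξ.im)
    rw [hξ, norm_sub_rev, sub_zero] at h3
    have h4 := norm_add_le (F (ξ + m) - partialF N (ξ + m)) (partialF N (ξ + m) - partialF N ξ)
    have h5 := norm_add_le (F (ξ + m) - partialF N ξ) (partialF N ξ)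
    rw [sub_add_sub_cancel] at h4
    rw [sub_add_cancel] at h5
    linarith

theorem tendsto_density_bound (c x : ℝ) :
    Tendsto (fun T : ℝ => (c * (T - x) - 1) / T) atTop (𝓝 c) := by
  have h : Tendsto (fun T : ℝ => c - (c * x + 1) * T⁻¹) atTop (𝓝 (c - (c * x + 1) * 0)) :=
    tendsto_const_nhds.sub (tendsto_inv_atTop_zero.const_mul _)
  rw [mul_zero, sub_zero] at h
  refine h.congr' ?_
  filter_upwards [eventually_ne_atTop 0] with T hT
  field_simp
  ring

/-- A lower bound for the density of zeros, from zeros in the translates `U + m` of a set of width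
less than `1`: these translates are disjoint. -/
theorem le_zeroDensity {U : Set ℂ} {c y x₀ x₁ : ℝ} (hy : 0 < y) (hx₁ : 0 < x₁)
    (hx : x₁ - x₀ < 1) (hU : ∀ z ∈ U, x₀ < z.re ∧ z.re < x₁ ∧ y < z.im) (hc : 0 ≤ c)
    (hzero : ∀ M : ℕ, ∃ A : Finset ℕ, (∀ m ∈ A, m ≤ M) ∧ c * (M + 1) ≤ A.card ∧
      ∀ m ∈ A, ∃ z ∈ U, F (z + m) = 0) :
    ENNReal.ofReal c ≤ zeroDensity := by
  refine le_liminf_of_le (by isBoundedDefault) ?_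
  have hY : ∀ᶠ Y in 𝓝[>] (0 : ℝ), Y < y := mem_nhdsWithin_of_mem_nhds (Iio_mem_nhds hy)
  filter_upwards [hY] with Y hY
  rw [← (ENNReal.tendsto_ofReal (tendsto_density_bound c x₁)).liminf_eq]
  refine liminf_le_liminf ?_ (by isBoundedDefault) (by isBoundedDefault)
  filter_upwards [eventually_ge_atTop x₁] with T hT
  have hT0 : 0 < T := hx₁.trans_le hT
  obtain ⟨A, hAM, hcard, hA⟩ := hzero ⌊T - x₁⌋₊
  choose! ζ hζU hζ using hA
  have hinj : Set.InjOn (fun m : ℕ => ζ m + m) (A.erase 0 : Finset ℕ) := by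
    intro m hm n hn hmn
    have hm' := hU _ (hζU m (Finset.mem_of_mem_erase hm))
    have hn' := hU _ (hζU n (Finset.mem_of_mem_erase hn))
    have hre : (ζ m).re + m = (ζ n).re + n := by simpa using congrArg Complex.re hmn
    have h1 : (m : ℝ) < n + 1 := by linarith
    have h2 : (n : ℝ) < m + 1 := by linarith
    have h1' : m < n + 1 := by exact_mod_cast h1
    have h2' : n < m + 1 := by exact_mod_cast h2
    omega
  -- The translate by `m = 0` is dropped, as `U` may reach into `Re z ≤ 0`.
  have hsub : ((A.erase 0).image (fun m : ℕ => ζ m + m) : Set ℂ)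
      ⊆ {z : ℂ | F z = 0 ∧ 0 < z.re ∧ z.re < T ∧ Y ≤ z.im} := by
    intro z hz
    rw [Finset.coe_image] at hz
    obtain ⟨m, hm, rfl⟩ := hz
    have hmA := Finset.mem_of_mem_erase hm
    have h := hU _ (hζU m hmA)
    have hm1 : (1 : ℝ) ≤ m := by
      exact_mod_cast Nat.one_le_iff_ne_zero.mpr (Finset.ne_of_mem_erase hm)
    have hmM : (m : ℝ) ≤ T - x₁ :=
      (Nat.cast_le.mpr (hAM m hmA)).trans (Nat.floor_le (by linarith))
    refine ⟨hζ m hmA, ?_, ?_, ?_⟩ <;> simp <;> linarith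
  have hencard : ((A.erase 0).card : ℕ∞)
      ≤ {z : ℂ | F z = 0 ∧ 0 < z.re ∧ z.re < T ∧ Y ≤ z.im}.encard := by
    rw [← Finset.card_image_of_injOn hinj, ← Set.encard_coe_eq_coe_finsetCard]
    exact Set.encard_le_encard hsub
  have hreal : c * (T - x₁) - 1 ≤ (A.erase 0).card := by
    have h1 : (A.card : ℝ) ≤ (A.erase 0).card + 1 := by
      have := Finset.pred_card_le_card_erase (s := A) (a := 0)
      exact_mod_cast (by omega : A.card ≤ (A.erase 0).card + 1)
    nlinarith [Nat.lt_floor_add_one (T - x₁)]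
  rw [ENNReal.ofReal_div_of_pos hT0, zeroFrequency]
  gcongr
  calc ENNReal.ofReal (c * (T - x₁) - 1) ≤ ENNReal.ofReal ((A.erase 0).card : ℝ) :=
        ENNReal.ofReal_le_ofReal hreal
    _ = (((A.erase 0).card : ℕ∞) : ENNReal) := by simp
    _ ≤ _ := by exact_mod_cast hencard

end ZetaSum

theorem lemma2p2 (hRH : RiemannHypothesis) (N q₀ : ℕ) (hq₀ : 0 < q₀)
    (ξ : ℂ) (hξre : 0 < ξ.re) (hξim : 0 < ξ.im) (hξ : ZetaSum.F ξ = 0)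
    (C : Set ℂ) (hC : ZetaSum.IsJordanCurve C) (hCξ : ZetaSum.Encloses C ξ)
    (hCim : ∀ z ∈ C, 0 < z.im)
    (α y₀ x₀ x₁ a a_w : ℝ) (b b_w : ENNReal)
    (hα : α = sInf ((fun z => ‖ZetaSum.partialF N z‖) '' C))
    (hy₀ : y₀ = sInf (Complex.im '' C))
    (hx₀ : x₀ = sInf (Complex.re '' C))
    (hx₁ : x₁ = sSup (Complex.re '' C))
    (ha : a = ZetaSum.headSum N y₀)
    (hb : b = ZetaSum.tailSum N y₀)
    (ha_w : a_w = ZetaSum.headSum N ξ.im)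
    (hb_w : b_w = ZetaSum.tailSum N ξ.im)
    (hαb : b + 2 * b_w < ENNReal.ofReal α)
    (hx : x₁ - x₀ < 1)
    (hq : 2 * a_w * Real.sin (Real.pi / q₀) + 2 * Real.pi * a / q₀
      ≤ α - b.toReal - 2 * b_w.toReal) :
    ((q₀ : ENNReal) ^ N)⁻¹ ≤ ZetaSum.zeroDensity := by
  obtain ⟨f, hf, -, hfC⟩ := hC
  have hCcpt : IsCompact C := hfC ▸ isCompact_range hf
  have hCne : C.Nonempty := hfC ▸ Set.range_nonempty f
  have hαC : ∀ z ∈ C, α ≤ ‖ZetaSum.partialF N z‖ := fun z hz =>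
    hα ▸ csInf_le ⟨0, by rintro _ ⟨w, -, rfl⟩; exact norm_nonneg _⟩ ⟨z, hz, rfl⟩
  have him := hCcpt.image Complex.continuous_im
  have hre := hCcpt.image Complex.continuous_re
  have hy₀C : ∀ z ∈ C, y₀ ≤ z.im := fun z hz => hy₀ ▸ csInf_le him.bddBelow ⟨z, hz, rfl⟩
  have hx₀C : ∀ z ∈ C, x₀ ≤ z.re := fun z hz => hx₀ ▸ csInf_le hre.bddBelow ⟨z, hz, rfl⟩
  have hx₁C : ∀ z ∈ C, z.re ≤ x₁ := fun z hz => hx₁ ▸ le_csSup hre.bddAbove ⟨z, hz, rfl⟩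
  have hy₀pos : 0 < y₀ := by
    obtain ⟨z, hz, hzy⟩ := him.sInf_mem (hCne.image _)
    rw [hy₀, ← hzy]
    exact hCim z hz
  set U := connectedComponentIn Cᶜ ξ with hUdef
  have hU : IsOpen U := hCcpt.isClosed.isOpen_compl.connectedComponentIn
  have hξU : ξ ∈ U := mem_connectedComponentIn hCξ.1
  have hfr : frontier U ⊆ C :=
    ZetaSum.frontier_connectedComponentIn_compl_subset hCcpt.isClosed ξ
  have hUbox : ∀ z ∈ U, x₀ < z.re ∧ z.re < x₁ ∧ y₀ < z.im := fun z hz => by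
    obtain ⟨c, hc, h⟩ := ZetaSum.exists_mem_frontier_lt hU hCξ.2 Complex.continuous_re
      Complex.isOpenMap_re hz
    obtain ⟨c', hc', h'⟩ := ZetaSum.exists_mem_frontier_gt hU hCξ.2 Complex.continuous_re
      Complex.isOpenMap_re hz
    obtain ⟨d, hd, h''⟩ := ZetaSum.exists_mem_frontier_lt hU hCξ.2 Complex.continuous_im
      Complex.isOpenMap_im hz
    exact ⟨(hx₀C c (hfr hc)).trans_lt h, h'.trans_le (hx₁C c' (hfr hc')),
      (hy₀C d (hfr hd)).trans_lt h''⟩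
  have hbtop : b ≠ ⊤ := fun h => by simp [h] at hαb
  have hbwtop : b_w ≠ ⊤ := fun h => by simp [h] at hαb
  have hαpos : 0 < α := ENNReal.ofReal_pos.mp (bot_le.trans_lt hαb)
  have hαa : α ≤ a := by
    obtain ⟨z, hz⟩ := hCne
    exact (hαC z hz).trans (ha ▸ ZetaSum.norm_partialF_le_headSum N (hy₀C z hz))
  have ha0 : 0 < a := hαpos.trans_le hαa
  have hb0 : 0 ≤ b.toReal := ENNReal.toReal_nonneg
  have hbw0 : 0 ≤ b_w.toReal := ENNReal.toReal_nonneg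
  have hπ := Real.pi_gt_three
  -- For `q₀ = 1` the hypothesis would give `2 π a ≤ α`, whereas `α ≤ a`.
  have hq2 : 2 ≤ q₀ := by
    by_contra h
    obtain rfl : q₀ = 1 := by omega
    simp only [Nat.cast_one, div_one, Real.sin_pi, mul_zero, zero_add] at hq
    nlinarith
  have hq' : (0 : ℝ) < q₀ := by exact_mod_cast hq₀
  have hsin : Real.sin (Real.pi / q₀) < Real.pi / q₀ := Real.sin_lt (by positivity)
  have hlt : 2 * Real.sin (Real.pi / q₀) * a_w + 2 * b_w.toReal
      < α - 2 * Real.sin (Real.pi / q₀) * a - b.toReal := by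
    have h1 : 2 * Real.sin (Real.pi / q₀) * a < 2 * (Real.pi / q₀) * a := by gcongr
    have h2 : 2 * Real.pi * a / q₀ = 2 * (Real.pi / q₀) * a := by ring
    linarith
  have hgoal : ((q₀ : ENNReal) ^ N)⁻¹ = ENNReal.ofReal (1 / (q₀ : ℝ) ^ N) := by
    rw [one_div, ENNReal.ofReal_inv_of_pos (by positivity), ENNReal.ofReal_pow hq'.le,
      ENNReal.ofReal_natCast]
  rw [hgoal]
  refine ZetaSum.le_zeroDensity hy₀pos (hξre.trans (hUbox ξ hξU).2.1) hx hUbox (by positivity)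
    fun M => ?_
  obtain ⟨A, hAM, hcard, hA⟩ := ZetaSum.exists_simultaneous_approx hq₀
    (fun n : Fin N => ZetaSum.ordinate (n + 1) / (2 * Real.pi)) M
  refine ⟨A, hAM, by rwa [one_div_mul_eq_div], fun m hm => ?_⟩
  refine ZetaSum.exists_zero_in_translate hRH hU hCξ.2 (fun z hz => (hUbox z hz).2.2)
    (fun z hz => hy₀C z (hfr hz)) (fun z hz => hαC z (hfr hz)) hξU hξ (hb ▸ hbtop)
    (hb_w ▸ hbwtop) (δ := 2 * Real.sin (Real.pi / q₀)) (fun k hk => ?_) ?_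
  · obtain ⟨j, hj⟩ := hA m hm ⟨k, hk⟩
    convert ZetaSum.norm_exp_sub_one_le_of_abs_sub_int_lt hq2 hj using 6
    field_simp
  · rwa [← ha, ← hb, ← ha_w, ← hb_w]
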